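/- Let $K$ be a field of characteristic zero, let $I$ be an ideal of the univariate polynomial algebra $K[x]$, and let $\delta : K[x] \to K[x]$ be a $K$-linear map. Call a $K$-subspace $V \subseteq K[x]$ a Mathieu subspace of $K[x]$ if for all $a, b \in K[x]$ such that $a^m \in V$ for all $m \ge 1$, one has $a^m b \in V$ for all sufficiently large $m$. Write $\mathrm{id}$ for the identity map of $K[x]$. Then the image $\delta I = \{\delta(f) : f \in I\}$ is a Mathieu subspace of $K[x]$ if one of the following conditions holds: 1. $\delta$ is a locally nilpotent $K$-derivation of $K[x]$, that is, a $K$-derivation such that for every $f \in K[x]$ there is $m \ge 0$ with $\delta^m(f) = 0$; 2. $\delta = \mathrm{id} - \phi$ for some $K$-algebra endomorphism $\phi$ of $K[x]$ with $\deg \phi(x) \ge 2$; 3. $\delta = \mathrm{id} - \phi$ for some $K$-algebra endomorphism $\phi$ of $K[x]$ with $\phi(x) = x + c$ for some $c \in K$, and $I = uK[x]$ for some $u \in K[x]$ such that $u = 0$, or $\deg u \le 1$, or $u$ has at least one repeated root in the algebraic closure of $K$. -/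

import Mathlib

open Polynomial

/-- A `K`-subspace `V` of a commutative `K`-algebra `A` is a Mathieu subspace (Mathieu–Zhao space)
if for all `a, b ∈ A` with `a ^ m ∈ V` for all `m ≥ 1`, one has `a ^ m * b ∈ V` for all
sufficiently large `m`. -/
def IsMathieuSubspace {K A : Type*} [Field K] [CommRing A] [Algebra K A]
    (V : Submodule K A) : Prop :=
  ∀ a b : A, (∀ m : ℕ, 1 ≤ m → a ^ m ∈ V) → ∃ N : ℕ, ∀ m : ℕ, N ≤ m → a ^ m * b ∈ V

/-- A linear endomorphism `δ` is locally nilpotent if every vector is killed by some power of `δ`. -/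
def IsLocallyNilpotent {K M : Type*} [Field K] [AddCommGroup M] [Module K M]
    (δ : M →ₗ[K] M) : Prop :=
  ∀ a : M, ∃ m : ℕ, (δ ^ m) a = 0

/-- `u` has a repeated root in the algebraic closure of `K`. -/
def HasRepeatedRoot {K : Type*} [Field K] (u : K[X]) : Prop :=
  ∃ r : AlgebraicClosure K,
    2 ≤ (u.map (algebraMap K (AlgebraicClosure K))).rootMultiplicity r

/-- The image `δ I` of an ideal `I` of `A` under a `K`-linear map `δ`, as a `K`-subspace of `A`. -/
def idealImage {K A : Type*} [Field K] [CommRing A] [Algebra K A]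
    (δ : A →ₗ[K] A) (I : Ideal A) : Submodule K A :=
  (Submodule.restrictScalars K I).map δ

-- Except where the image is zero, everything or an ideal, the only `a` with all positive powers in
-- the image is `0`; this makes the condition trivial. For `id - φ` with `deg φ(X) ≥ 2`, a degree
-- argument in `eq_zero_of_sub_aeval` needs only `a` and `a ^ 2`. The other two cases use a linear
-- functional that kills every power of `a`. A locally nilpotent derivation is `c · d/dx`; if `u`
-- has distinct roots `r, s`, integration from `r` to `s` kills the image, with moments `1 / (k +
-- 1)` after rescaling. For a shift and a double root `r` of `u`, the functional `X ^ k ↦ B_k` turns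
-- `G(x + 1) - G(x)` into `G'(0)`, which vanishes after moving `r` to `0`. Both moment sequences
-- first acquire a pole at a prime `p` at index `p - 1`. By
-- `eq_zero_of_momentFunctional_pow_eq_zero`, a power of a nonzero `a` of degree exactly `p - 1`
-- then has nonzero value.

universe v

/-! ### Specialisation to number fields and `p`-integrality -/

theorem exists_algHom_finite {A : Type v} [CommRing A] [Nontrivial A] [Algebra ℚ A]
    [Algebra.FiniteType ℚ A] :
    ∃ (F : Type v) (_ : Field F) (_ : Algebra ℚ F), Module.Finite ℚ F ∧
      Nonempty (A →ₐ[ℚ] F) := by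
  obtain ⟨M, hM⟩ := Ideal.exists_maximal A
  exact ⟨A ⧸ M, Ideal.Quotient.field M, Ideal.Quotient.algebra ℚ,
    @finite_of_finite_type_of_isJacobsonRing ℚ (A ⧸ M) _ (Ideal.Quotient.field M) _ _ _,
    ⟨Ideal.Quotient.mkₐ ℚ M⟩⟩

/-- This replaces a `p`-adic valuation on `L`: specialise `ℚ[S]` to a number field and pull back the
elements integral up to denominators prime to `p`. -/
theorem exists_subring_inv_prime_notMem {L : Type*} [Field L] [CharZero L] (S : Finset L) :
    ∃ N : ℕ, ∀ p : ℕ, p.Prime → N < p → ∃ B : Subring L, (∀ s ∈ S, s ∈ B) ∧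
      (p : L)⁻¹ ∉ B ∧ ∀ n : ℕ, n.Coprime p → (n : L)⁻¹ ∈ B := by
  classical
  let Q := Algebra.adjoin ℚ (S : Set L)
  have : Algebra.FiniteType ℚ Q :=
    (Subalgebra.fg_iff_finiteType _).1 (Subalgebra.fg_adjoin_finset S)
  obtain ⟨F, _, _, _, ⟨π⟩⟩ := exists_algHom_finite (A := Q)
  have : CharZero F := algebraRat.charZero F
  have : Algebra.IsAlgebraic ℤ F :=
    (IsFractionRing.comap_isAlgebraic_iff (A := ℤ) (K := ℚ) (C := F)).2
      (Algebra.IsAlgebraic.of_finite ℚ F)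
  have hSQ : ∀ s ∈ S, s ∈ Q := fun s hs => Algebra.subset_adjoin hs
  -- A common denominator `y` of the images of `S`; every prime above `|y|` is coprime to it.
  obtain ⟨y, hy0, hy⟩ := Algebra.IsAlgebraic.exists_integral_multiples ℤ
    (S.attach.image fun s : S => π ⟨s.1, hSQ s.1 s.2⟩)
  refine ⟨y.natAbs, fun p hp hlt => ?_⟩
  have hyp : y.natAbs.Coprime p :=
    (Nat.coprime_of_lt_prime (by simpa using hy0) hlt hp).symm
  let BF : Subring F :=
    { carrier := {w | ∃ n : ℕ, n.Coprime p ∧ IsIntegral ℤ ((n : F) * w)}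
      mul_mem' := by
        rintro a b ⟨n, hn, ha⟩ ⟨m, hm, hb⟩
        refine ⟨n * m, hn.mul_left hm, ?_⟩
        have := ha.mul hb
        rwa [mul_mul_mul_comm, ← Nat.cast_mul] at this
      one_mem' := ⟨1, by simp, by simpa using isIntegral_one⟩
      add_mem' := by
        rintro a b ⟨n, hn, ha⟩ ⟨m, hm, hb⟩
        refine ⟨n * m, hn.mul_left hm, ?_⟩
        have h : ((n * m : ℕ) : F) * (a + b) = n * a * m + m * b * n := by
          push_cast
          ring
        rw [h]
        exact (ha.mul (isIntegral_natCast m)).add (hb.mul (isIntegral_natCast n))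
      zero_mem' := ⟨1, by simp, by simpa using isIntegral_zero⟩
      neg_mem' := by
        rintro a ⟨n, hn, ha⟩
        exact ⟨n, hn, by simpa using ha.neg⟩ }
  refine ⟨(BF.comap π.toRingHom).map Q.val.toRingHom, fun s hs => ?_, ?_, fun n hn => ?_⟩
  · refine ⟨⟨s, hSQ s hs⟩, ⟨y.natAbs, hyp, ?_⟩, rfl⟩
    have h := hy (π ⟨s, hSQ s hs⟩)
      (Finset.mem_image.2 ⟨⟨s, hs⟩, Finset.mem_attach _ _, rfl⟩)
    rcases Int.natAbs_eq y with h' | h'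
    · rw [h'] at h
      simpa [zsmul_eq_mul] using h
    · rw [h'] at h
      simpa [zsmul_eq_mul] using h.neg
  · rintro ⟨x, ⟨n, hn, hx⟩, hxp⟩
    have hx' : x = algebraMap ℚ Q (p : ℚ)⁻¹ := Subtype.ext (by
      rw [show (x : L) = (p : L)⁻¹ from hxp]
      change _ = algebraMap ℚ L _
      simp)
    subst hx'
    have h1 : IsIntegral ℤ (algebraMap ℚ F (n * (p : ℚ)⁻¹)) := by
      have : π.toRingHom (algebraMap ℚ Q (p : ℚ)⁻¹) = algebraMap ℚ F (p : ℚ)⁻¹ := π.commutes _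
      rw [this] at hx
      simpa using hx
    -- A rational number integral over `ℤ` is an integer, so `p` would divide `n`, against
    -- coprimality.
    have h2 : IsIntegral ℤ (n * (p : ℚ)⁻¹) :=
      (isIntegral_algebraMap_iff (algebraMap ℚ F).injective).1 h1
    obtain ⟨z, hz⟩ := IsIntegrallyClosed.isIntegral_iff.1 h2
    have hp0 : (p : ℚ) ≠ 0 := by exact_mod_cast hp.ne_zero
    have h3 : (z : ℚ) * p = n := by
      have : (z : ℚ) = n * (p : ℚ)⁻¹ := by simpa using hz
      rw [this]; field_simp
    have h4 : (p : ℤ) ∣ n := ⟨z, by rw [mul_comm]; exact_mod_cast h3.symm⟩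
    exact hp.one_lt.ne' (Nat.eq_one_of_dvd_coprimes hn (Int.natCast_dvd_natCast.1 h4) dvd_rfl)
  · refine ⟨algebraMap ℚ Q (n : ℚ)⁻¹, ⟨n, hn, ?_⟩, ?_⟩
    · have : π.toRingHom (algebraMap ℚ Q (n : ℚ)⁻¹) = algebraMap ℚ F (n : ℚ)⁻¹ := π.commutes _
      rw [this]
      by_cases h0 : (n : F) = 0
      · simpa [h0] using isIntegral_zero
      · rw [map_inv₀, map_natCast, mul_inv_cancel₀ h0]
        exact isIntegral_one
    · change algebraMap ℚ L _ = _
      simp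

/-! ### Functionals with prime-polar moments -/

/-- A sequence of "moments" is prime-polar if, for each prime `p`, its terms of index less than
`p - 1` are `p`-integral, and its term of index `p - 1` is `±1 / p` up to a `p`-integral error. -/
def IsPrimePolar {L : Type*} [Field L] (q : ℕ → L) : Prop :=
  ∀ (p : ℕ) (B : Subring L), p.Prime → (∀ n : ℕ, n.Coprime p → (n : L)⁻¹ ∈ B) →
    (∀ k < p - 1, q k ∈ B) ∧ (q (p - 1) - (p : L)⁻¹ ∈ B ∨ q (p - 1) + (p : L)⁻¹ ∈ B)

/-- The linear functional on polynomials with value `q k` at `X ^ k`. -/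
noncomputable def momentFunctional {L : Type*} [Field L] (q : ℕ → L) : L[X] →ₗ[L] L :=
  Polynomial.lsum fun k => q k • LinearMap.id

theorem momentFunctional_X_pow {L : Type*} [Field L] (q : ℕ → L) (k : ℕ) :
    momentFunctional q (X ^ k) = q k := by
  rw [← monomial_one_right_eq_X_pow]
  simp [momentFunctional, lsum_apply, sum_monomial_index]

theorem momentFunctional_eq_sum_range {L : Type*} [Field L] (q : ℕ → L) (f : L[X]) :
    momentFunctional q f = ∑ k ∈ Finset.range (f.natDegree + 1), f.coeff k * q k := by
  conv_lhs => rw [f.as_sum_range_C_mul_X_pow]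
  simp [← smul_eq_C_mul, momentFunctional_X_pow]

theorem eq_zero_of_momentFunctional_pow_eq_zero {L : Type*} [Field L] [CharZero L] {q : ℕ → L}
    (hq : IsPrimePolar q) (hq0 : q 0 ≠ 0) {a : L[X]}
    (h : ∀ m : ℕ, 1 ≤ m → momentFunctional q (a ^ m) = 0) : a = 0 := by
  classical
  by_contra ha
  by_cases hd : a.natDegree = 0
  · have h1 := h 1 le_rfl
    rw [pow_one, momentFunctional_eq_sum_range, hd] at h1
    simp only [zero_add, Finset.range_one, Finset.sum_singleton, mul_eq_zero, hq0, or_false] at h1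
    rw [eq_C_of_natDegree_eq_zero hd, h1] at ha
    simp at ha
  obtain ⟨N, hN⟩ := exists_subring_inv_prime_notMem
    (insert a.leadingCoeff⁻¹ ((Finset.range (a.natDegree + 1)).image a.coeff))
  -- Since `p ≡ 1` modulo `deg a`, some power `a ^ m` has degree exactly `p - 1`, so only its
  -- leading term meets the pole at `p`.
  obtain ⟨p, hpN, hp, hmod⟩ :=
    Nat.forall_exists_prime_gt_and_modEq N hd (Nat.coprime_one_left a.natDegree)
  obtain ⟨B, hS, hpB, hB⟩ := hN p hp hpN
  obtain ⟨m, hm⟩ := (Nat.modEq_iff_dvd' hp.one_lt.le).1 hmod.symm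
  have hm1 : 1 ≤ m := by
    rcases Nat.eq_zero_or_pos m with rfl | h'
    · have := hp.one_lt
      omega
    · exact h'
  have hcoeff : ∀ k, a.coeff k ∈ B := by
    intro k
    by_cases hk : k < a.natDegree + 1
    · exact hS _ (Finset.mem_insert_of_mem (Finset.mem_image_of_mem _ (Finset.mem_range.2 hk)))
    · rw [coeff_eq_zero_of_natDegree_lt (by omega)]
      exact B.zero_mem
  have hlift : a ∈ Polynomial.lifts B.subtype :=
    (lifts_iff_coeff_lifts _).2 fun k => ⟨⟨_, hcoeff k⟩, rfl⟩
  have hpow : ∀ k, (a ^ m).coeff k ∈ B := by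
    intro k
    obtain ⟨x, hx⟩ := (lifts_iff_coeff_lifts _).1 (pow_mem hlift m) k
    rw [← hx]
    exact x.2
  obtain ⟨hlow, htop⟩ := hq p B hp hB
  have hz := h m hm1
  have hdeg : (a ^ m).natDegree = p - 1 := by rw [natDegree_pow, hm, mul_comm]
  rw [momentFunctional_eq_sum_range, Finset.sum_range_succ, hdeg] at hz
  have hsum : ∑ k ∈ Finset.range (p - 1), (a ^ m).coeff k * q k ∈ B :=
    sum_mem fun k hk => B.mul_mem (hpow k) (hlow k (Finset.mem_range.1 hk))
  have hlead : (a ^ m).coeff (p - 1) = a.leadingCoeff ^ m := by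
    rw [← hdeg, coeff_natDegree, leadingCoeff_pow]
  have hinv : (a.leadingCoeff⁻¹) ^ m ∈ B := pow_mem (hS _ (Finset.mem_insert_self _ _)) m
  have hl0 : a.leadingCoeff ^ m ≠ 0 := pow_ne_zero _ (leadingCoeff_ne_zero.2 ha)
  have hqp : q (p - 1) ∈ B := by
    have : q (p - 1) = -((a.leadingCoeff⁻¹) ^ m *
        ∑ k ∈ Finset.range (p - 1), (a ^ m).coeff k * q k) := by
      rw [eq_neg_of_add_eq_zero_left hz, hlead, inv_pow]
      field_simp
    rw [this]
    exact B.neg_mem (B.mul_mem hinv hsum)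
  apply hpB
  rcases htop with h' | h'
  · simpa using B.sub_mem hqp h'
  · simpa using B.sub_mem h' hqp

theorem isPrimePolar_inv_succ (L : Type*) [Field L] :
    IsPrimePolar fun k : ℕ => ((k + 1 : ℕ) : L)⁻¹ := by
  intro p B hp hB
  refine ⟨fun k hk => hB _ ((Nat.coprime_of_lt_prime (by omega) (by omega) hp).symm), Or.inl ?_⟩
  simp only [Nat.sub_add_cancel hp.one_lt.le, sub_self]
  exact B.zero_mem

/-- The part of von Staudt–Clausen needed here follows from the recursion for `(k + 1) B_k`: below
index `p - 1` one divides only by integers prime to `p`. -/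
theorem isPrimePolar_bernoulli (L : Type*) [Field L] [CharZero L] :
    IsPrimePolar fun k : ℕ => ((bernoulli k : ℚ) : L) := by
  intro p B hp hB
  have hrec : ∀ k : ℕ, ((k + 1 : ℕ) : L) * ((bernoulli k : ℚ) : L) = (if k = 0 then 1 else 0) -
      ∑ i ∈ Finset.range k, ((k + 1).choose i : L) * ((bernoulli i : ℚ) : L) := by
    intro k
    have h := congrArg (Rat.cast : ℚ → L) (sum_bernoulli (k + 1))
    rw [Finset.sum_range_succ] at h
    simp only [Nat.choose_succ_self_right, add_eq_right] at h
    rw [apply_ite (Rat.cast : ℚ → L)] at h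
    push_cast at h ⊢
    rw [← h]
    ring
  have hlow : ∀ k < p - 1, ((bernoulli k : ℚ) : L) ∈ B := by
    intro k
    induction k using Nat.strong_induction_on with
    | _ k ih =>
      intro hk
      have h0 : ((k + 1 : ℕ) : L) ≠ 0 := Nat.cast_ne_zero.2 k.succ_ne_zero
      rw [(eq_inv_mul_iff_mul_eq₀ h0).2 (hrec k)]
      refine B.mul_mem (hB _ ((Nat.coprime_of_lt_prime (by omega) (by omega) hp).symm))
        (B.sub_mem ?_ (sum_mem fun i hi => ?_))
      · split_ifs
        exacts [B.one_mem, B.zero_mem]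
      · have hi' := Finset.mem_range.1 hi
        exact B.mul_mem (natCast_mem B _) (ih i hi' (by omega))
  refine ⟨hlow, Or.inr ?_⟩
  obtain ⟨n, rfl⟩ : ∃ n, p = n + 2 := ⟨p - 2, by have := hp.two_le; omega⟩
  have hp0 : ((n + 2 : ℕ) : L) ≠ 0 := Nat.cast_ne_zero.2 (by omega)
  have h := hrec (n + 1)
  -- The `i = 0` term gives `-1 / p`; the other binomials are divisible by `p`, which cancels the
  -- division by `p`.
  rw [Finset.sum_range_succ'] at h
  simp only [Nat.succ_ne_zero, if_false, Nat.choose_zero_right, _root_.bernoulli_zero] at h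
  have hsum : ((n + 2 : ℕ) : L)⁻¹ *
      ∑ i ∈ Finset.range n, ((n + 2).choose (i + 1) : L) * ((bernoulli (i + 1) : ℚ) : L) ∈ B := by
    rw [Finset.mul_sum]
    refine sum_mem fun i hi => ?_
    have hi' := Finset.mem_range.1 hi
    obtain ⟨t, ht⟩ := hp.dvd_choose_self (k := i + 1) (by omega) (by omega)
    rw [ht, Nat.cast_mul, mul_assoc, inv_mul_cancel_left₀ hp0]
    exact B.mul_mem (natCast_mem B _) (hlow _ (by omega))
  change ((bernoulli (n + 1) : ℚ) : L) + _ ∈ B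
  rw [(eq_inv_mul_iff_mul_eq₀ hp0).2 h]
  convert B.neg_mem hsum using 1
  push_cast
  ring

/-! ### Criteria for Mathieu subspaces -/

section Mathieu

variable {K A : Type*} [Field K] [CommRing A] [Algebra K A]

theorem isMathieuSubspace_of_forall_eq_zero {V : Submodule K A}
    (h : ∀ a : A, (∀ m : ℕ, 1 ≤ m → a ^ m ∈ V) → a = 0) : IsMathieuSubspace V := by
  intro a b ha
  refine ⟨1, fun m hm => ?_⟩
  rw [h a ha, zero_pow (by omega), zero_mul]
  exact V.zero_mem

theorem isMathieuSubspace_of_eq_bot [IsReduced A] {V : Submodule K A} (h : V = ⊥) :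
    IsMathieuSubspace V :=
  isMathieuSubspace_of_forall_eq_zero fun a ha => by simpa [h] using ha 1 le_rfl

theorem isMathieuSubspace_restrictScalars (J : Ideal A) :
    IsMathieuSubspace (J.restrictScalars K) := by
  intro a b ha
  refine ⟨1, fun m hm => ?_⟩
  exact J.mul_mem_right b (ha m hm)

theorem isMathieuSubspace_top : IsMathieuSubspace (⊤ : Submodule K A) :=
  fun _ _ _ => ⟨0, fun _ _ => Submodule.mem_top⟩

theorem mem_idealImage {δ : A →ₗ[K] A} {I : Ideal A} {g : A} :
    g ∈ idealImage δ I ↔ ∃ f ∈ I, δ f = g := Iff.rfl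

theorem idealImage_bot (δ : A →ₗ[K] A) : idealImage δ ⊥ = ⊥ := by
  ext g
  simp [mem_idealImage, eq_comm]

theorem idealImage_zero (I : Ideal A) : idealImage (0 : A →ₗ[K] A) I = ⊥ := by
  ext g
  simp only [mem_idealImage, LinearMap.zero_apply, Submodule.mem_bot]
  exact ⟨fun ⟨_, _, h⟩ => h.symm, fun h => ⟨0, I.zero_mem, h.symm⟩⟩

end Mathieu

/-! ### Endomorphisms of degree at least two -/

section Composition

variable {K : Type*} [Field K]

theorem natDegree_aeval_polynomial (f g : K[X]) :
    (aeval f g).natDegree = g.natDegree * f.natDegree := by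
  rw [← natDegree_comp]; rfl

theorem aeval_polynomial_injective {f : K[X]} (hf : f.natDegree ≠ 0) :
    Function.Injective (aeval f : K[X] →ₐ[K] K[X]) :=
  (injective_iff_map_eq_zero _).2 fun g hg => by
    have h : g.natDegree * f.natDegree = 0 := by rw [← natDegree_aeval_polynomial, hg, natDegree_zero]
    rw [eq_C_of_natDegree_eq_zero ((Nat.mul_eq_zero.1 h).resolve_right hf)] at hg ⊢
    simpa using hg

/-- Modulo the polynomials in `f`, every polynomial outside `K[f]` can be brought to a degree that
is not a multiple of `deg f`. -/
theorem exists_sub_aeval_natDegree_not_dvd {f : K[X]} (hf : f.natDegree ≠ 0) (h : K[X])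
    (hh : ∀ g : K[X], aeval f g ≠ h) :
    ∃ g : K[X], (h - aeval f g).natDegree ≤ h.natDegree ∧
      ¬ f.natDegree ∣ (h - aeval f g).natDegree := by
  induction hn : h.natDegree using Nat.strong_induction_on generalizing h with
  | _ n ih =>
    by_cases hd : f.natDegree ∣ h.natDegree
    · obtain ⟨k, hk⟩ := hd
      have hh0 : h ≠ 0 := fun h0 => hh 0 (by simp [h0])
      have hf0 : f ≠ 0 := fun h0 => hf (by simp [h0])
      have hl : f.leadingCoeff ^ k ≠ 0 := pow_ne_zero _ (leadingCoeff_ne_zero.2 hf0)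
      set t : K[X] := C (h.leadingCoeff / f.leadingCoeff ^ k) * X ^ k with ht
      have hft : aeval f t = C (h.leadingCoeff / f.leadingCoeff ^ k) * f ^ k := by simp [ht]
      have hc : h.leadingCoeff / f.leadingCoeff ^ k ≠ 0 :=
        div_ne_zero (leadingCoeff_ne_zero.2 hh0) hl
      have hft0 : aeval f t ≠ 0 := by
        rw [hft]; exact mul_ne_zero (C_ne_zero.2 hc) (pow_ne_zero _ hf0)
      have hlead : (aeval f t).leadingCoeff = h.leadingCoeff := by
        rw [hft, leadingCoeff_mul, leadingCoeff_C, leadingCoeff_pow, div_mul_cancel₀ _ hl]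
      have hdeg : (aeval f t).natDegree = h.natDegree := by
        rw [hft, natDegree_C_mul hc, natDegree_pow, hk, mul_comm]
      have hlt : (h - aeval f t).degree < h.degree :=
        degree_sub_lt_left (by rw [degree_eq_natDegree hh0, degree_eq_natDegree hft0, hdeg]) hh0
          hlead.symm
      have hne : h - aeval f t ≠ 0 := fun h0 => hh t (sub_eq_zero.1 h0).symm
      have hlt' : (h - aeval f t).natDegree < n := hn ▸ natDegree_lt_natDegree hne hlt
      obtain ⟨g, hg1, hg2⟩ := ih _ hlt' (h - aeval f t)
        (fun g hg => hh (g + t) (by rw [map_add, hg]; ring)) rfl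
      refine ⟨t + g, ?_, ?_⟩
      · rw [map_add, ← sub_sub]; omega
      · rwa [map_add, ← sub_sub]
    · exact ⟨0, by simp [hn], by simpa using hd⟩

theorem natDegree_sub_aeval {f g : K[X]} (hf : 2 ≤ f.natDegree) :
    (g - aeval f g).natDegree = g.natDegree * f.natDegree := by
  rw [← natDegree_aeval_polynomial]
  by_cases hg : g.natDegree = 0
  · rw [eq_C_of_natDegree_eq_zero hg]; simp
  · apply natDegree_sub_eq_right_of_natDegree_lt
    rw [natDegree_aeval_polynomial]
    nlinarith [Nat.pos_of_ne_zero hg]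

/-- If `h ∈ K[f]`, the whole situation pulls back along `f` to smaller degree. Otherwise the cross
term of `a ^ 2` forces a degree in `K[f]` that is not a multiple of `deg f`. -/
theorem eq_zero_of_sub_aeval [CharZero K] {f : K[X]} (hf : 2 ≤ f.natDegree) (a : K[X])
    (h1 : ∃ h : K[X], h - aeval f h = a) (h2 : ∃ g : K[X], g - aeval f g = a ^ 2) : a = 0 := by
  have hf0 : f.natDegree ≠ 0 := by omega
  induction hn : a.natDegree using Nat.strong_induction_on generalizing a with
  | _ n ih =>
    obtain ⟨h, rfl⟩ := h1
    obtain ⟨g, hg⟩ := h2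
    rw [natDegree_sub_aeval hf] at hn
    by_cases hh0 : h.natDegree = 0
    · rw [eq_C_of_natDegree_eq_zero hh0]; simp
    by_cases hK : ∃ h₁ : K[X], aeval f h₁ = h
    · obtain ⟨h₁, rfl⟩ := hK
      have hg1 : ∃ g₁ : K[X], aeval f g₁ = g :=
        ⟨g + (h₁ - aeval f h₁) ^ 2, by rw [map_add, map_pow, map_sub, ← hg]; ring⟩
      obtain ⟨g₁, rfl⟩ := hg1
      have h0 : h₁ - aeval f h₁ = 0 := by
        refine ih _ ?_ _ ⟨h₁, rfl⟩ ⟨g₁, aeval_polynomial_injective hf0 ?_⟩ rfl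
        · rw [natDegree_sub_aeval hf, ← hn, natDegree_aeval_polynomial]
          rw [natDegree_aeval_polynomial] at hh0
          nlinarith [Nat.pos_of_ne_zero hh0]
        · rw [map_sub, map_pow, map_sub, hg]
      rw [← map_sub, h0, map_zero]
    · exfalso
      push Not at hK
      obtain ⟨h₀, hle, hnd⟩ := exists_sub_aeval_natDegree_not_dvd hf0 h hK
      set e := h - aeval f h₀ with he
      have hepos : e.natDegree ≠ 0 := fun h' => hnd (h' ▸ dvd_zero _)
      have hP : (aeval f (h₀ - h)).natDegree = h.natDegree * f.natDegree := by
        have : aeval f (h₀ - h) = (h - e) - aeval f h := by rw [map_sub, he]; ring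
        rw [this, ← natDegree_aeval_polynomial]
        apply natDegree_sub_eq_right_of_natDegree_lt
        have := natDegree_sub_le h e
        rw [natDegree_aeval_polynomial]
        have : h.natDegree * 2 ≤ h.natDegree * f.natDegree := Nat.mul_le_mul_left _ hf
        have := max_le le_rfl hle
        omega
      have hgdeg : g.natDegree * f.natDegree = 2 * (h.natDegree * f.natDegree) := by
        rw [← natDegree_sub_aeval hf, hg, natDegree_pow, natDegree_sub_aeval hf]
      have hg2 : g.natDegree = 2 * h.natDegree := by
        apply Nat.eq_of_mul_eq_mul_right (Nat.pos_of_ne_zero hf0)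
        rw [hgdeg, mul_assoc]
      have hP0 : aeval f (h₀ - h) ≠ 0 := by
        intro h'
        rw [h', natDegree_zero] at hP
        rcases Nat.mul_eq_zero.1 hP.symm with h' | h' <;> contradiction
      have he0 : e ≠ 0 := fun h' => hepos (by rw [h', natDegree_zero])
      -- Write `a = P + e` with `P = aeval f (h₀ - h)` and expand `a ^ 2 = g - aeval f g`. The term
      -- `2 P e` dominates, because `e ^ 2` and `g` have degree at most `2 deg h ≤ deg P` and `deg e
      -- > 0`.
      have key : C 2 * (aeval f (h₀ - h) * e) + (e ^ 2 - g) =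
          aeval f (-g - (h₀ - h) ^ 2) := by
        have hC : (C (2 : K)) = 2 := rfl
        have ha : h - aeval f h = aeval f (h₀ - h) + e := by rw [map_sub, he]; ring
        rw [ha] at hg
        rw [hC, map_sub (aeval f) (-g), map_neg, map_pow]
        linear_combination -hg
      have hmain : (C 2 * (aeval f (h₀ - h) * e)).natDegree =
          h.natDegree * f.natDegree + e.natDegree := by
        rw [natDegree_C_mul two_ne_zero, natDegree_mul hP0 he0, hP]
      have hlow : (e ^ 2 - g).natDegree < (C 2 * (aeval f (h₀ - h) * e)).natDegree := by
        rw [hmain]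
        have h1 := natDegree_sub_le (e ^ 2) g
        rw [natDegree_pow, hg2] at h1
        have : h.natDegree * 2 ≤ h.natDegree * f.natDegree := Nat.mul_le_mul_left _ hf
        omega
      apply hnd
      have hdvd : f.natDegree ∣ h.natDegree * f.natDegree + e.natDegree := by
        rw [← hmain, ← natDegree_add_eq_left_of_natDegree_lt hlow, key,
          natDegree_aeval_polynomial]
        exact dvd_mul_left _ _
      exact (Nat.dvd_add_right (dvd_mul_left _ _)).1 hdvd

theorem isMathieuSubspace_idealImage_id_sub_of_two_le_degree [CharZero K] (I : Ideal K[X])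
    (φ : K[X] →ₐ[K] K[X]) (hφ : 2 ≤ (φ X).degree) :
    IsMathieuSubspace (idealImage (LinearMap.id - φ.toLinearMap) I) := by
  have hd : 2 ≤ (φ X).natDegree := le_natDegree_of_coe_le_degree hφ
  have happ : ∀ g, φ g = aeval (φ X) g := fun g => by
    rw [aeval_algHom_apply, aeval_X_left_apply]
  refine isMathieuSubspace_of_forall_eq_zero fun a ha => eq_zero_of_sub_aeval hd a ?_ ?_
  · obtain ⟨g, -, hg⟩ := ha 1 le_rfl
    refine ⟨g, ?_⟩
    rw [pow_one] at hg
    rw [← happ]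
    exact hg
  · obtain ⟨g, -, hg⟩ := ha 2 one_le_two
    refine ⟨g, ?_⟩
    rw [← happ]
    exact hg

end Composition

/-! ### The integration and Bernoulli functionals -/

section Moments

variable {L : Type*} [Field L]

theorem momentFunctional_monomial (q : ℕ → L) (k : ℕ) (c : L) :
    momentFunctional q (monomial k c) = c * q k := by
  rw [← C_mul_X_pow_eq_monomial, ← smul_eq_C_mul, map_smul, momentFunctional_X_pow, smul_eq_mul]

theorem natDegree_C_mul_X_add_C_ne_zero {b : L} (hb : b ≠ 0) (r : L) :
    (C b * X + C r).natDegree ≠ 0 := by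
  rw [natDegree_linear hb]
  exact one_ne_zero

theorem eq_zero_of_comp_linear_eq_zero {A : L[X]} {b r : L} (hb : b ≠ 0)
    (h : A.comp (C b * X + C r) = 0) : A = 0 :=
  aeval_polynomial_injective (natDegree_C_mul_X_add_C_ne_zero hb r) (by
    rw [map_zero]
    exact h)

variable [CharZero L]

theorem momentFunctional_inv_succ_derivative (G : L[X]) :
    momentFunctional (fun k : ℕ => ((k + 1 : ℕ) : L)⁻¹) (derivative G) = G.eval 1 - G.eval 0 := by
  induction G using Polynomial.induction_on' with
  | add f g hf hg => simp only [map_add, hf, hg, eval_add]; ring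
  | monomial n c =>
    rw [derivative_monomial, momentFunctional_monomial]
    cases n with
    | zero => simp
    | succ n =>
      have : ((n + 1 : ℕ) : L) ≠ 0 := Nat.cast_ne_zero.2 n.succ_ne_zero
      simp only [Nat.add_sub_cancel, mul_assoc, mul_inv_cancel₀ this]
      simp

/-- On `X ^ n` this is the defining recursion: the sum of `n.choose k * B_k` over `k < n` is `1` if
`n = 1` and `0` otherwise. -/
theorem momentFunctional_bernoulli_shift_sub (G : L[X]) :
    momentFunctional (fun k : ℕ => ((bernoulli k : ℚ) : L)) (G.comp (X + C 1) - G) =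
      (derivative G).eval 0 := by
  induction G using Polynomial.induction_on' with
  | add f g hf hg =>
    rw [add_comp, add_sub_add_comm, map_add, hf, hg, derivative_add, eval_add]
  | monomial n c =>
    have hX : (X + C 1 : L[X]) ^ n - X ^ n =
        ∑ k ∈ Finset.range n, monomial k (n.choose k : L) := by
      rw [add_pow, Finset.sum_range_succ]
      simp only [← C_mul_X_pow_eq_monomial]
      simp [mul_comm]
    have h := congrArg (Rat.cast : ℚ → L) (sum_bernoulli n)
    rw [apply_ite (Rat.cast : ℚ → L)] at h
    push_cast at h
    rw [monomial_comp, ← C_mul_X_pow_eq_monomial, ← mul_sub, hX, ← smul_eq_C_mul, map_smul, map_sum]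
    simp only [momentFunctional_monomial, h]
    rcases n with _ | _ | n <;> simp

/-- If all powers of `A` have, up to a constant, a primitive vanishing at two distinct points, then
`A = 0`. -/
theorem eq_zero_of_pow_eq_derivative {A : L[X]} {r s c : L} (hrs : r ≠ s)
    (h : ∀ m : ℕ, 1 ≤ m → ∃ G : L[X], G.eval r = 0 ∧ G.eval s = 0 ∧ derivative G * C c = A ^ m) :
    A = 0 := by
  have hb : s - r ≠ 0 := sub_ne_zero.2 hrs.symm
  apply eq_zero_of_comp_linear_eq_zero (r := r) hb
  refine eq_zero_of_momentFunctional_pow_eq_zero (isPrimePolar_inv_succ L) (by simp)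
    fun m hm => ?_
  obtain ⟨G, hr, hs, hG⟩ := h m hm
  have hc : (s - r) • (A.comp (C (s - r) * X + C r)) ^ m =
      c • derivative (G.comp (C (s - r) * X + C r)) := by
    rw [← pow_comp, ← hG, derivative_comp]
    simp only [smul_eq_C_mul, mul_comp, C_comp, derivative_add, derivative_mul, derivative_C,
      derivative_X, zero_mul, mul_one, zero_add, add_zero]
    ring
  have h' := congrArg (momentFunctional fun k : ℕ => ((k + 1 : ℕ) : L)⁻¹) hc
  rw [map_smul, map_smul, momentFunctional_inv_succ_derivative] at h'
  simpa [eval_comp, hr, hs, hb] using h'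

/-- If every power of `A` is a difference `G - G(X + c)` with `G'(r) = 0`, then `A = 0`. -/
theorem eq_zero_of_pow_eq_sub_shift {A : L[X]} {r c : L} (hc : c ≠ 0)
    (h : ∀ m : ℕ, 1 ≤ m → ∃ G : L[X], (derivative G).eval r = 0 ∧
      G - G.comp (X + C c) = A ^ m) : A = 0 := by
  apply eq_zero_of_comp_linear_eq_zero (r := r) hc
  refine eq_zero_of_momentFunctional_pow_eq_zero (isPrimePolar_bernoulli L) (by simp)
    fun m hm => ?_
  obtain ⟨G, hr, hG⟩ := h m hm
  have hA : (A.comp (C c * X + C r)) ^ m =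
      -((G.comp (C c * X + C r)).comp (X + C 1) - G.comp (C c * X + C r)) := by
    rw [← pow_comp, ← hG, sub_comp, comp_assoc, comp_assoc, neg_sub]
    congr 2
    simp only [add_comp, mul_comp, X_comp, C_comp, C_1]
    ring
  rw [hA, map_neg, momentFunctional_bernoulli_shift_sub, derivative_comp]
  simp [eval_comp, hr]

end Moments

/-! ### Locally nilpotent derivations -/

section Derivation

variable {K : Type*} [Field K]

theorem derivation_apply_eq_derivative_mul (D : Derivation K K[X] K[X]) (f : K[X]) :
    D f = derivative f * D X := by
  have h : D = mkDerivation K (D X) := derivation_ext (by simp)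
  conv_lhs => rw [h]
  rw [mkDerivation_apply, smul_eq_mul]

variable [CharZero K]

theorem exists_derivation_X_eq_C {D : Derivation K K[X] K[X]}
    (hD : IsLocallyNilpotent (D : K[X] →ₗ[K] K[X])) : ∃ c : K, D X = C c := by
  by_contra hc
  have hn : (D X).natDegree ≠ 0 := fun h => hc ⟨_, eq_C_of_natDegree_eq_zero h⟩
  have hX0 : D X ≠ 0 := fun h => hn (by simp [h])
  -- If `D X` is nonconstant, `D` keeps nonconstant polynomials nonconstant, so no iterate kills
  -- `X`.
  have key : ∀ m : ℕ, (((D : K[X] →ₗ[K] K[X]) ^ m) X).natDegree ≠ 0 := by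
    intro m
    induction m with
    | zero => simp
    | succ m ih =>
      rw [pow_succ', Module.End.mul_apply]
      set g := ((D : K[X] →ₗ[K] K[X]) ^ m) X
      change (D g).natDegree ≠ 0
      have hg : derivative g ≠ 0 := fun h => ih (derivative_eq_zero.1 h)
      rw [derivation_apply_eq_derivative_mul, natDegree_mul hg hX0]
      omega
  obtain ⟨m, hm⟩ := hD X
  exact key m (by rw [hm, natDegree_zero])

theorem derivative_surjective : Function.Surjective (derivative : K[X] →ₗ[K] K[X]) := by
  intro g
  induction g using Polynomial.induction_on' with
  | add f g hf hg =>
    obtain ⟨F, rfl⟩ := hf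
    obtain ⟨G, rfl⟩ := hg
    exact ⟨F + G, map_add _ _ _⟩
  | monomial n c =>
    refine ⟨monomial (n + 1) (c / ((n + 1 : ℕ) : K)), ?_⟩
    rw [derivative_monomial, div_mul_cancel₀ _ (Nat.cast_ne_zero.2 n.succ_ne_zero)]
    rfl

theorem X_sub_C_pow_dvd_of_derivative {G : K[X]} {r : K} {n : ℕ} (hr : G.IsRoot r)
    (h : (X - C r) ^ (n - 1) ∣ derivative G) : (X - C r) ^ n ∣ G := by
  by_cases hG : G = 0
  · simp [hG]
  have hG' : derivative G ≠ 0 := by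
    intro h0
    have hC := eq_C_of_natDegree_eq_zero (derivative_eq_zero.1 h0)
    rw [hC, IsRoot.def, eval_C] at hr
    exact hG (by rw [hC, hr, C_0])
  have h1 := (le_rootMultiplicity_iff hG').2 h
  rw [derivative_rootMultiplicity_of_root hr] at h1
  have h2 := (rootMultiplicity_pos hG).2 hr
  exact (le_rootMultiplicity_iff hG).1 (by omega)

/-- The single root is read off from the second coefficient, after division by the degree, so it
lies in `K` in characteristic zero. -/
theorem eq_C_mul_X_sub_C_pow_of_forall_root_eq {u : K[X]} (hu : u.natDegree ≠ 0)
    (h : ∀ r s : AlgebraicClosure K, aeval r u = 0 → aeval s u = 0 → r = s) :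
    ∃ r : K, u = C u.leadingCoeff * (X - C r) ^ u.natDegree := by
  let L := AlgebraicClosure K
  let i := algebraMap K L
  have hi : Function.Injective i := i.injective
  have hu0 : u ≠ 0 := fun h0 => hu (by simp [h0])
  have hsp : (u.map i).Splits := IsAlgClosed.splits _
  have hcard : (u.map i).roots.card = u.natDegree := by
    rw [← hsp.natDegree_eq_card_roots, natDegree_map]
  obtain ⟨ρ, hρ⟩ := Multiset.card_pos_iff_exists_mem.1 (hcard ▸ Nat.pos_of_ne_zero hu)
  have hroot : ∀ s ∈ (u.map i).roots, aeval s u = 0 := fun s hs => by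
    have := isRoot_of_mem_roots hs
    rwa [IsRoot.def, eval_map_algebraMap] at this
  have hrep : (u.map i).roots = Multiset.replicate u.natDegree ρ :=
    Multiset.eq_replicate.2 ⟨hcard, fun s hs => h s ρ (hroot s hs) (hroot ρ hρ)⟩
  have hnext := hsp.nextCoeff_eq_neg_sum_roots_mul_leadingCoeff
  rw [hrep, Multiset.sum_replicate, nextCoeff_map hi, leadingCoeff_map, nsmul_eq_mul] at hnext
  have hl : i u.leadingCoeff ≠ 0 := (map_ne_zero i).2 (leadingCoeff_ne_zero.2 hu0)
  have hn : (u.natDegree : L) ≠ 0 := Nat.cast_ne_zero.2 hu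
  have hρK : i (-u.nextCoeff / (u.leadingCoeff * u.natDegree)) = ρ := by
    rw [map_div₀, map_neg, map_mul, map_natCast, hnext, div_eq_iff (mul_ne_zero hl hn)]
    ring
  refine ⟨-u.nextCoeff / (u.leadingCoeff * u.natDegree), map_injective i hi ?_⟩
  conv_lhs => rw [hsp.eq_prod_roots, hrep]
  simp only [leadingCoeff_map, Multiset.map_replicate, Multiset.prod_replicate, Polynomial.map_mul,
    Polynomial.map_pow, Polynomial.map_sub, map_X, map_C, hρK]

theorem isMathieuSubspace_idealImage_of_isLocallyNilpotent (I : Ideal K[X])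
    (D : Derivation K K[X] K[X]) (hD : IsLocallyNilpotent (D : K[X] →ₗ[K] K[X])) :
    IsMathieuSubspace (idealImage (D : K[X] →ₗ[K] K[X]) I) := by
  obtain ⟨c, hc⟩ := exists_derivation_X_eq_C hD
  have hDf : ∀ f, (D : K[X] →ₗ[K] K[X]) f = derivative f * C c := fun f => by
    rw [← hc]; exact derivation_apply_eq_derivative_mul D f
  by_cases hc0 : c = 0
  · have : (D : K[X] →ₗ[K] K[X]) = 0 := LinearMap.ext fun f => by simp [hDf, hc0]
    exact isMathieuSubspace_of_eq_bot (by rw [this, idealImage_zero])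
  have hcc : C c⁻¹ * C c = 1 := by rw [← C_mul, inv_mul_cancel₀ hc0, C_1]
  obtain ⟨u, rfl⟩ := (IsPrincipalIdealRing.principal I).principal
  change IsMathieuSubspace (idealImage _ (Ideal.span {u}))
  by_cases h : ∀ r s : AlgebraicClosure K, aeval r u = 0 → aeval s u = 0 → r = s
  · by_cases hu0 : u = 0
    · exact isMathieuSubspace_of_eq_bot (by rw [hu0, Ideal.span_singleton_eq_bot.2 rfl,
        idealImage_bot])
    -- With at most one root, the image is the ideal of `(X - r) ^ (n - 1)`. A unit `u` is the case
    -- `n = 0`, where truncated subtraction correctly gives the whole ring.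
    suffices hJ : ∃ (r : K) (n : ℕ), u ∣ (X - C r) ^ n ∧ (X - C r) ^ n ∣ u by
      obtain ⟨r, n, hur, hru⟩ := hJ
      have : idealImage (D : K[X] →ₗ[K] K[X]) (Ideal.span {u}) =
          (Ideal.span {(X - C r) ^ (n - 1)}).restrictScalars K := by
        ext g
        rw [mem_idealImage, Submodule.restrictScalars_mem, Ideal.mem_span_singleton]
        constructor
        · rintro ⟨f, hf, rfl⟩
          rw [hDf]
          exact dvd_mul_of_dvd_left (pow_sub_one_dvd_derivative_of_pow_dvd
            (hru.trans (Ideal.mem_span_singleton.1 hf))) _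
        · intro hg
          obtain ⟨G, hG⟩ := derivative_surjective (g * C c⁻¹)
          have hG' : derivative (G - C (G.eval r)) = g * C c⁻¹ := by simp [hG]
          refine ⟨G - C (G.eval r), Ideal.mem_span_singleton.2 (hur.trans ?_), ?_⟩
          · apply X_sub_C_pow_dvd_of_derivative (by simp)
            rw [hG']
            exact dvd_mul_of_dvd_left hg _
          · rw [hDf, hG', mul_assoc, hcc, mul_one]
      rw [this]
      exact isMathieuSubspace_restrictScalars _
    have hl : IsUnit (C u.leadingCoeff) :=
      isUnit_C.2 (isUnit_iff_ne_zero.2 (leadingCoeff_ne_zero.2 hu0))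
    by_cases hdeg : u.natDegree = 0
    · have hu : IsUnit u := by
        rw [eq_C_of_natDegree_eq_zero hdeg, ← hdeg]
        exact hl
      exact ⟨0, 0, hu.dvd, by simp⟩
    · obtain ⟨r, hr⟩ := eq_C_mul_X_sub_C_pow_of_forall_root_eq hdeg h
      refine ⟨r, u.natDegree, ?_, ?_⟩
      · conv_lhs => rw [hr]
        exact hl.mul_left_dvd.2 dvd_rfl
      · conv_rhs => rw [hr]
        exact dvd_mul_left _ _
  · push Not at h
    obtain ⟨r, s, hr, hs, hrs⟩ := h
    refine isMathieuSubspace_of_forall_eq_zero fun a ha => ?_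
    have hA : a.map (algebraMap K (AlgebraicClosure K)) = 0 := by
      refine eq_zero_of_pow_eq_derivative (c := algebraMap K _ c) hrs fun m hm => ?_
      obtain ⟨G, hG, hGa⟩ := ha m hm
      obtain ⟨w, rfl⟩ := Ideal.mem_span_singleton.1 hG
      refine ⟨(u * w).map (algebraMap K _), ?_, ?_, ?_⟩
      · rw [eval_map_algebraMap, map_mul, hr, zero_mul]
      · rw [eval_map_algebraMap, map_mul, hs, zero_mul]
      · rw [hDf] at hGa
        rw [derivative_map, ← map_C, ← Polynomial.map_mul, hGa, Polynomial.map_pow]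
    exact (Polynomial.map_eq_zero _).1 hA

end Derivation

/-! ### Translations -/

section Shift

variable {K : Type*} [Field K]

theorem exists_forall_dvd_of_degree_le_one {u : K[X]} (hu0 : u ≠ 0) (hu : u.degree ≤ 1) :
    ∃ r : K, ∀ f : K[X], f.eval r = 0 → u ∣ f := by
  by_cases h1 : u.degree = 1
  · obtain ⟨r, hr⟩ := exists_root_of_degree_eq_one h1
    refine ⟨r, fun f hf => ?_⟩
    have h := (irreducible_X_sub_C r).dvd_symm (irreducible_of_degree_eq_one h1)
      (dvd_iff_isRoot.2 hr)
    exact h.trans (dvd_iff_isRoot.2 hf)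
  · have h0 : u.degree = 0 := by
      rw [degree_eq_natDegree hu0] at *
      norm_cast at *
      omega
    exact ⟨0, fun f _ => (isUnit_iff_degree_eq_zero.2 h0).dvd⟩

variable [CharZero K]

/-- The difference operator lowers degree by one: `X ^ (n + 1)` maps to `-(n + 1) c X ^ n` plus
lower terms, so induction reaches every monomial. -/
theorem exists_sub_comp_X_add_C_eq {c : K} (hc : c ≠ 0) (g : K[X]) :
    ∃ G : K[X], G - G.comp (X + C c) = g := by
  let T : K[X] →ₗ[K] K[X] := LinearMap.id - (aeval (X + C c) : K[X] →ₐ[K] K[X]).toLinearMap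
  have hT : ∀ G, T G = G - G.comp (X + C c) := fun G => rfl
  have hX : ∀ n : ℕ, (X ^ n : K[X]) ∈ LinearMap.range T := by
    intro n
    induction n using Nat.strong_induction_on with
    | _ n ih =>
      have h : T (X ^ (n + 1)) = -(((n + 1 : ℕ) * c : K) • X ^ n +
          ∑ k ∈ Finset.range n, (c ^ (n + 1 - k) * ((n + 1).choose k : K)) • (X ^ k : K[X])) := by
        rw [hT, X_pow_comp, add_pow, Finset.sum_range_succ, Finset.sum_range_succ]
        simp only [smul_eq_C_mul, C_mul, C_pow, C_eq_natCast, Nat.choose_succ_self_right,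
          Nat.choose_self, Nat.sub_self, Nat.add_sub_cancel_left]
        simp only [mul_comm, mul_left_comm]
        ring
      have h1 : ((n + 1 : ℕ) * c : K) • (X ^ n : K[X]) ∈ LinearMap.range T := by
        have h2 : ((n + 1 : ℕ) * c : K) • (X ^ n : K[X]) = -T (X ^ (n + 1)) -
            ∑ k ∈ Finset.range n, (c ^ (n + 1 - k) * ((n + 1).choose k : K)) • (X ^ k : K[X]) := by
          rw [h]; ring
        rw [h2]
        exact sub_mem (neg_mem ⟨_, rfl⟩) (sum_mem fun k hk =>
          Submodule.smul_mem _ _ (ih k (Finset.mem_range.1 hk)))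
      exact (Submodule.smul_mem_iff _
        (mul_ne_zero (Nat.cast_ne_zero.2 n.succ_ne_zero) hc)).1 h1
  have hg : g ∈ LinearMap.range T := by
    rw [g.as_sum_range_C_mul_X_pow]
    refine sum_mem fun k _ => ?_
    rw [← smul_eq_C_mul]
    exact Submodule.smul_mem _ _ (hX k)
  exact hg

theorem isMathieuSubspace_idealImage_id_sub_shift (φ : K[X] →ₐ[K] K[X]) (c : K) (u : K[X])
    (hφ : φ X = X + C c) (hu : u = 0 ∨ u.degree ≤ 1 ∨ HasRepeatedRoot u) :
    IsMathieuSubspace (idealImage (LinearMap.id - φ.toLinearMap) (Ideal.span {u})) := by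
  have happ : ∀ g : K[X], (LinearMap.id - φ.toLinearMap : K[X] →ₗ[K] K[X]) g = g - g.comp (X + C c) := fun g => by
    change g - φ g = _
    rw [← hφ]
    congr 1
    change φ g = aeval (φ X) g
    rw [aeval_algHom_apply, aeval_X_left_apply]
  by_cases hc : c = 0
  · have : LinearMap.id - φ.toLinearMap = 0 := LinearMap.ext fun f => by simp [happ, hc]
    exact isMathieuSubspace_of_eq_bot (by rw [this, idealImage_zero])
  by_cases hu0 : u = 0
  · exact isMathieuSubspace_of_eq_bot (by rw [hu0, Ideal.span_singleton_eq_bot.2 rfl,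
      idealImage_bot])
  rcases hu with hu | hu | ⟨r, hr⟩
  · exact absurd hu hu0
  · obtain ⟨r, hr⟩ := exists_forall_dvd_of_degree_le_one hu0 hu
    have : idealImage (LinearMap.id - φ.toLinearMap) (Ideal.span {u}) = ⊤ := by
      refine eq_top_iff.2 fun g _ => ?_
      obtain ⟨G, rfl⟩ := exists_sub_comp_X_add_C_eq hc g
      -- Constants are invariant under the shift, so a preimage can be made to vanish at `r`, hence
      -- to lie in the ideal.
      refine ⟨G - C (G.eval r), Ideal.mem_span_singleton.2 (hr _ (by simp)), ?_⟩
      rw [happ, sub_comp, C_comp]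
      ring
    rw [this]
    exact isMathieuSubspace_top
  · refine isMathieuSubspace_of_forall_eq_zero fun a ha => ?_
    have hA : a.map (algebraMap K (AlgebraicClosure K)) = 0 := by
      refine eq_zero_of_pow_eq_sub_shift (r := r) (c := algebraMap K _ c)
        ((_root_.map_ne_zero _).2 hc) fun m hm => ?_
      obtain ⟨G, hG, hGa⟩ := ha m hm
      refine ⟨G.map (algebraMap K _), ?_, ?_⟩
      · have h2 : (X - C r) ^ 2 ∣ G.map (algebraMap K (AlgebraicClosure K)) :=
          ((le_rootMultiplicity_iff ((Polynomial.map_ne_zero_iff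
            (algebraMap K (AlgebraicClosure K)).injective).2 hu0)).1 hr).trans
            (Polynomial.map_dvd _ (Ideal.mem_span_singleton.1 hG))
        have h1 := pow_sub_one_dvd_derivative_of_pow_dvd h2
        rwa [show 2 - 1 = 1 from rfl, pow_one, dvd_iff_isRoot] at h1
      · rw [happ] at hGa
        rw [← Polynomial.map_pow, ← hGa, Polynomial.map_sub, map_comp]
        simp
    exact (Polynomial.map_eq_zero _).1 hA

end Shift

theorem theorem1p6 {K : Type*} [Field K] [CharZero K]
    (I : Ideal K[X]) (δ : K[X] →ₗ[K] K[X])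
    (h :
      -- `δ` is a locally nilpotent `K`-derivation
      (∃ D : Derivation K K[X] K[X], δ = (D : K[X] →ₗ[K] K[X]) ∧ IsLocallyNilpotent δ) ∨
      -- `δ = id - φ` with `deg φ(x) ≥ 2`
      (∃ φ : K[X] →ₐ[K] K[X], δ = LinearMap.id - φ.toLinearMap ∧ 2 ≤ (φ X).degree) ∨
      -- `δ = id - φ` with `φ(x) = x + c`, and `I = (u)` for a suitable `u`
      (∃ (φ : K[X] →ₐ[K] K[X]) (c : K) (u : K[X]),
        δ = LinearMap.id - φ.toLinearMap ∧ φ X = X + C c ∧ I = Ideal.span {u} ∧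
        (u = 0 ∨ u.degree ≤ 1 ∨ HasRepeatedRoot u))) :
    IsMathieuSubspace (idealImage δ I) := by
  rcases h with ⟨D, rfl, hD⟩ | ⟨φ, rfl, hφ⟩ | ⟨φ, c, u, rfl, hφ, rfl, hu⟩
  · exact isMathieuSubspace_idealImage_of_isLocallyNilpotent I D hD
  · exact isMathieuSubspace_idealImage_id_sub_of_two_le_degree I φ hφ
  · exact isMathieuSubspace_idealImage_id_sub_shift φ c u hφ hu
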